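/- Let $v,k,t$ be integers with $0\le t\le k\le v/2$. For $0\le j\le k$ let $W_{jk}$ be the inclusion matrix whose rows and columns are indexed by the $j$-subsets and the $k$-subsets of a fixed $v$-set, with $W_{jk}(J,K)=1$ if $J\subseteq K$ and $0$ otherwise. For $i\ge 0$ let $A_{kk}^i$ be the matrix indexed by the $k$-subsets with $A_{kk}^i(K,K')=\binom{|K\cap K'|}{i}$, and consider $$F_{kk}^t(z)=\sum_{i=0}^t A_{kk}^i z^i$$ as a matrix over the field of rational functions $\mathbb R(z)$. Let $R_j(z)\subseteq \mathbb R(z)^{\binom vk}$ be the row space of $W_{jk}$ over $\mathbb R(z)$, let $\perp$ denote the orthogonal complement with respect to the standard bilinear form $\sum_K x_Ky_K$, and put $V_0(z)=R_0(z)$ and $V_j(z)=R_j(z)\cap R_{j-1}(z)^\perp$ for $1\le j\le k$. For $0\le j\le t$ put $$\mu_j(z)=\sum_{i=j}^t\binom{k-j}{i-j}\binom{v-j-i}{k-i}z^i .$$ Then, with the convention $\binom{v}{-1}=0$, the characteristic polynomial of $F_{kk}^t(z)$ is $$x^{\binom vk-\binom vt}\prod_{j=0}^t\bigl(x-\mu_j(z)\bigr)^{\binom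 vj-\binom v{j-1}}.$$ Moreover, for each $0\le j\le t$, $\mu_j(z)$ is an eigenvalue of $F_{kk}^t(z)$ (acting on column vectors), its eigenspace is exactly $V_j(z)$, and $\dim V_j(z)=\binom vj-\binom v{j-1}$. The kernel of $F_{kk}^t(z)$ (the eigenspace for $0$) is exactly $R_t(z)^\perp$, of dimension $\binom vk-\binom vt$ (which is zero when $t=k$). -/

import Mathlib

namespace IntersectionMatrix

/-- The `k`-subsets of the `v`-set `Fin v`. -/
abbrev KSubset (v k : ℕ) : Type := {S : Finset (Fin v) // S.card = k}

/-- The inclusion matrix `W_{sk}(v)`: rows are indexed by `s`-subsets, columns by `k`-subsets, and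
the entry at `(S, K)` is `1` if `S ⊆ K` and `0` otherwise. -/
def W (𝕜 : Type*) [Field 𝕜] (v s k : ℕ) : Matrix (KSubset v s) (KSubset v k) 𝕜 :=
  Matrix.of fun S K => if S.1 ⊆ K.1 then 1 else 0

/-- The intersection matrix `A_{sk}^i(v)`, with entry `C(|S ∩ K|, i)` at `(S, K)`. -/
def A (𝕜 : Type*) [Field 𝕜] (v s k i : ℕ) : Matrix (KSubset v s) (KSubset v k) 𝕜 :=
  Matrix.of fun S K => ((S.1 ∩ K.1).card.choose i : 𝕜)

/-- The matrix `F_{sk}^t(v)(z) = ∑_{i=0}^t A_{sk}^i(v) z^i`. -/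
def F {𝕜 : Type*} [Field 𝕜] (v s k t : ℕ) (z : 𝕜) : Matrix (KSubset v s) (KSubset v k) 𝕜 :=
  ∑ i ∈ Finset.range (t + 1), z ^ i • A 𝕜 v s k i

/-- The row space `R_j` of `W_{jk}(v)` over the field `𝕜`. -/
def R (𝕜 : Type*) [Field 𝕜] (v k j : ℕ) : Submodule 𝕜 (KSubset v k → 𝕜) :=
  Submodule.span 𝕜 (Set.range (W 𝕜 v j k).row)

/-- The orthogonal complement with respect to the standard symmetric bilinear form
`⟨x, y⟩ = ∑ K, x K * y K`. -/
def perp {𝕜 : Type*} [Field 𝕜] {ι : Type*} [Fintype ι] (U : Submodule 𝕜 (ι → 𝕜)) :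
    Submodule 𝕜 (ι → 𝕜) :=
  U.orthogonalBilin (dotProductBilin 𝕜 𝕜)

/-- `V_0 = R_0` and `V_j = R_j ∩ R_{j-1}^⊥` for `j ≥ 1`. -/
def V (𝕜 : Type*) [Field 𝕜] (v k : ℕ) : ℕ → Submodule 𝕜 (KSubset v k → 𝕜)
  | 0 => R 𝕜 v k 0
  | j + 1 => R 𝕜 v k (j + 1) ⊓ perp (R 𝕜 v k j)

/-- `μ_j(z) = ∑_{i=j}^t C(k-j, i-j) C(v-j-i, k-i) z^i`. -/
def mu {𝕜 : Type*} [Field 𝕜] (v k t j : ℕ) (z : 𝕜) : 𝕜 :=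
  ∑ i ∈ Finset.Icc j t, ((k - j).choose (i - j) : 𝕜) * ((v - j - i).choose (k - i) : 𝕜) * z ^ i

/-- The multiplicity `C(v, j) - C(v, j-1)`, where `C(v, -1) = 0`. -/
def mult (v : ℕ) : ℕ → ℕ
  | 0 => v.choose 0
  | j + 1 => v.choose (j + 1) - v.choose j

end IntersectionMatrix

/-! Since `A^i = W_iᵀ W_i`, the matrix `F` kills `R_t^⊥`. If `h` on `j`-subsets is harmonic (killed
by `W_{lj}` for `l < j`), the expansion `W_mul_transpose` of `W_{ik} W_{jk}ᵀ` acts on `h` through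
its term `l = j` alone, so `W_{jk}ᵀ h` satisfies the eigenvalue equation for `μ_j`.

Rank-nullity bounds the dimensions of these spaces from below, and the bounds telescope to `C(v,k)`.
Over `ℝ(z)` the `μ_j` are distinct and nonzero, having lowest term of degree exactly `j`;
eigenspaces are then independent and every bound is an equality. The rank of `W_{tk}` and the
nondegeneracy of the form on `R_t` are consequences, and they identify the harmonic images with
`V_j`. -/

namespace IntersectionMatrix

open Finset Module

/-! ### Dimension counts for eigenspaces -/

section LinearAlgebra

variable {𝕜 M ι : Type*} [Field 𝕜] [AddCommGroup M] [Module 𝕜 M] [FiniteDimensional 𝕜 M]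

/-- Eigenvectors for distinct eigenvalues whose number reaches the dimension determine the
characteristic polynomial. -/
theorem charpoly_eq_prod_of_finrank_le_sum [Fintype ι] (f : End 𝕜 M) (a : ι → 𝕜)
    (ha : Function.Injective a) (d : ι → ℕ) (hd : ∀ i, d i ≤ finrank 𝕜 (f.eigenspace (a i)))
    (hsum : finrank 𝕜 M ≤ ∑ i, d i) :
    f.charpoly = ∏ i, (Polynomial.X - Polynomial.C (a i)) ^ d i := by
  have hmonic : (∏ i, (Polynomial.X - Polynomial.C (a i)) ^ d i).Monic :=
    Polynomial.monic_prod_of_monic _ _ fun i _ => (Polynomial.monic_X_sub_C _).pow _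
  have hdvd : (∏ i, (Polynomial.X - Polynomial.C (a i)) ^ d i) ∣ f.charpoly := by
    refine Fintype.prod_dvd_of_coprime (fun i j hij => ?_) fun i => ?_
    · exact (Polynomial.pairwise_coprime_X_sub_C ha hij).pow
    · exact (pow_dvd_pow _ ((hd i).trans (LinearMap.finrank_eigenspace_le f (a i)))).trans
        (Polynomial.pow_rootMultiplicity_dvd _ _)
  refine (Polynomial.eq_of_monic_of_dvd_of_natDegree_le hmonic f.charpoly_monic hdvd ?_)
  rw [f.charpoly_natDegree, Polynomial.natDegree_prod_of_monic _ _
    fun i _ => (Polynomial.monic_X_sub_C _).pow _]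
  simpa using hsum

theorem finrank_iSup_of_iSupIndep [Fintype ι] (E : ι → Submodule 𝕜 M) (hE : iSupIndep E) :
    finrank 𝕜 (⨆ i, E i : Submodule 𝕜 M) = ∑ i, finrank 𝕜 (E i) := by
  classical
  rw [Submodule.iSup_eq_range_dfinsupp_lsum,
    LinearMap.finrank_range_of_inj hE.dfinsupp_lsum_injective]
  exact finrank_directSum (R := 𝕜) (fun i => E i)

/-- Independence caps the total dimension of the eigenspaces at `finrank 𝕜 M`, which squeezes all
inequalities to equalities. An `E i` may be zero, so `t = k` needs no separate case. -/
theorem eigenspace_eq_of_finrank_le_sum [Fintype ι] (f : End 𝕜 M) (a : ι → 𝕜)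
    (ha : Function.Injective a) (d : ι → ℕ) (E : ι → Submodule 𝕜 M)
    (hE : ∀ i, E i ≤ f.eigenspace (a i)) (hd : ∀ i, d i ≤ finrank 𝕜 (E i))
    (hsum : finrank 𝕜 M ≤ ∑ i, d i) :
    (∀ i, f.eigenspace (a i) = E i ∧ finrank 𝕜 (E i) = d i) ∧ ⨆ i, E i = ⊤ := by
  have hind : iSupIndep fun i => f.eigenspace (a i) := f.eigenspaces_iSupIndep.comp ha
  have hle : ∑ i, finrank 𝕜 (f.eigenspace (a i)) ≤ finrank 𝕜 M := by
    rw [← finrank_iSup_of_iSupIndep _ hind]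
    exact Submodule.finrank_le _
  have hdle : ∀ i ∈ univ, d i ≤ finrank 𝕜 (f.eigenspace (a i)) := fun i _ =>
    (hd i).trans (Submodule.finrank_mono (hE i))
  have heq := (Finset.sum_eq_sum_iff_of_le hdle).1
    ((Finset.sum_le_sum hdle).antisymm (hle.trans hsum))
  have hfin : ∀ i, f.eigenspace (a i) = E i ∧ finrank 𝕜 (E i) = d i := fun i => by
    have h1 := heq i (mem_univ i)
    have h2 := Submodule.finrank_mono (hE i)
    have h3 := hd i
    exact ⟨(Submodule.eq_of_le_of_finrank_eq (hE i) (by omega)).symm, by omega⟩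
  refine ⟨hfin, Submodule.eq_top_of_finrank_eq ?_⟩
  have hind' : iSupIndep E := hind.mono hE
  refine (Submodule.finrank_le _).antisymm ?_
  rw [finrank_iSup_of_iSupIndep _ hind']
  exact hsum.trans (Finset.sum_le_sum fun i _ => hd i)

end LinearAlgebra

/-! ### Inclusion matrices and their products -/

section Inclusion

variable (𝕜 : Type*) [Field 𝕜]

theorem card_kSubset (v k : ℕ) : Fintype.card (KSubset v k) = v.choose k := by
  simp [KSubset]

theorem card_filter_subset {v : ℕ} (l : ℕ) (U : Finset (Fin v)) :
    #{L : KSubset v l | L.1 ⊆ U} = (#U).choose l := by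
  rw [← card_powersetCard, ← card_map (Function.Embedding.subtype _)]
  congr 1
  ext L
  simp [mem_powersetCard]

/-- Complementation in `U` gives the `(#U - k)`-subsets of `U \ S`. Unlike `k - #S`, this lower
index stays correct under truncated subtraction when `k < #S`. -/
theorem card_filter_subset_subset {v k : ℕ} {S U : Finset (Fin v)} (hSU : S ⊆ U) (hk : k ≤ #U) :
    #{K : KSubset v k | S ⊆ K.1 ∧ K.1 ⊆ U} = (#U - #S).choose (#U - k) := by
  rw [← card_sdiff_of_subset hSU, ← card_powersetCard]
  refine card_bij (fun K _ => U \ K.1) ?_ ?_ ?_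
  · intro K hK
    simp only [mem_filter, mem_univ, true_and] at hK
    rw [mem_powersetCard, card_sdiff_of_subset hK.2, K.2]
    exact ⟨sdiff_subset_sdiff subset_rfl hK.1, rfl⟩
  · intro K hK K' hK' h
    simp only [mem_filter, mem_univ, true_and] at hK hK'
    apply Subtype.ext
    rw [← Finset.sdiff_sdiff_eq_self hK.2, ← Finset.sdiff_sdiff_eq_self hK'.2]
    exact congrArg (U \ ·) h
  · intro T hT
    rw [mem_powersetCard] at hT
    have hTU : T ⊆ U := hT.1.trans sdiff_subset
    refine ⟨⟨U \ T, by rw [card_sdiff_of_subset hTU, hT.2]; omega⟩, ?_, Finset.sdiff_sdiff_eq_self hTU⟩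
    simp only [mem_filter, mem_univ, true_and, sdiff_subset, and_true]
    intro x hx
    exact mem_sdiff.2 ⟨hSU hx, fun hxT => (mem_sdiff.1 (hT.1 hxT)).2 hx⟩

open Matrix

theorem A_eq_transpose_mul (v i k : ℕ) : A 𝕜 v k k i = (W 𝕜 v i k)ᵀ * W 𝕜 v i k := by
  ext K K'
  simp only [A, W, mul_apply, transpose_apply, of_apply, boole_mul, ← ite_and,
    ← subset_inter_iff, sum_boole, card_filter_subset]

theorem W_mul_W {v l i k : ℕ} (hik : i ≤ k) :
    W 𝕜 v l i * W 𝕜 v i k = ((k - l).choose (k - i) : 𝕜) • W 𝕜 v l k := by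
  ext L K
  simp only [W, mul_apply, of_apply, Matrix.smul_apply, boole_mul, ← ite_and, smul_eq_mul,
    sum_boole]
  split_ifs with h
  · rw [card_filter_subset_subset h (by rw [K.2]; exact hik), K.2, L.2, mul_one]
  · rw [filter_false_of_mem fun I _ hI => h (hI.1.trans hI.2)]
    simp

theorem W_self (v j : ℕ) : W 𝕜 v j j = 1 := by
  ext J J'
  simp only [W, of_apply, one_apply]
  congr 1
  rw [eq_iff_iff, Subtype.ext_iff]
  exact ⟨fun h => eq_of_subset_of_card_le h (by rw [J.2, J'.2]), fun h => h.subset⟩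

theorem W_eq_zero {v l j : ℕ} (h : j < l) : W 𝕜 v l j = 0 := by
  ext L J
  simp only [W, of_apply, Matrix.zero_apply, ite_eq_right_iff, one_ne_zero, imp_false]
  intro hLJ
  have := card_le_card hLJ
  rw [L.2, J.2] at this
  omega

/-- Expansion of `W_{ik} W_{jk}ᵀ` along the products `W_{li}ᵀ W_{lj}`. -/
theorem W_mul_transpose {v i j k : ℕ} (hij : i + j ≤ v) (hk : k ≤ v) :
    W 𝕜 v i k * (W 𝕜 v j k)ᵀ = ∑ l ∈ range (v - k + 1),
      ((v - i - j).choose (v - k - l) : 𝕜) • ((W 𝕜 v l i)ᵀ * W 𝕜 v l j) := by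
  ext I J
  have hR : ∀ l, ((W 𝕜 v l i)ᵀ * W 𝕜 v l j) I J = ((#(I.1 ∩ J.1)).choose l : 𝕜) := fun l => by
    simp only [W, mul_apply, transpose_apply, of_apply, boole_mul, ← ite_and,
      ← subset_inter_iff, sum_boole, card_filter_subset]
  have hL : (W 𝕜 v i k * (W 𝕜 v j k)ᵀ) I J = ((v - #(I.1 ∪ J.1)).choose (v - k) : 𝕜) := by
    have := card_filter_subset_subset (k := k) (subset_univ (I.1 ∪ J.1)) (by simpa using hk)
    simp only [card_univ, Fintype.card_fin, subset_univ, and_true] at this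
    simp only [W, mul_apply, transpose_apply, of_apply, boole_mul, ← ite_and,
      ← union_subset_iff, sum_boole, this]
  have hcard : v - #(I.1 ∪ J.1) = #(I.1 ∩ J.1) + (v - i - j) := by
    have h1 := card_union_add_card_inter I.1 J.1
    have h2 : #(I.1 ∪ J.1) ≤ v := by simpa using card_le_univ (I.1 ∪ J.1)
    rw [I.2, J.2] at h1
    omega
  -- Vandermonde's identity for `#(I ∩ J) + (v - i - j)`.
  simp only [Matrix.sum_apply, Matrix.smul_apply, hR, hL, hcard, Nat.add_choose_eq, smul_eq_mul,
    Nat.sum_antidiagonal_eq_sum_range_succ_mk, Nat.cast_sum, Nat.cast_mul]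
  exact sum_congr rfl fun l _ => mul_comm _ _

theorem mem_R_iff {v k j : ℕ} {x : KSubset v k → 𝕜} :
    x ∈ R 𝕜 v k j ↔ ∃ y, (W 𝕜 v j k)ᵀ *ᵥ y = x := by
  rw [R, ← range_vecMulLinear]
  simp [mulVec_transpose]

theorem perp_R (v k j : ℕ) : perp (R 𝕜 v k j) = LinearMap.ker (W 𝕜 v j k).mulVecLin := by
  ext x
  simp only [perp, Submodule.mem_orthogonalBilin_iff, LinearMap.mem_ker, mulVecLin_apply]
  constructor
  · intro h
    ext J
    exact h _ (Submodule.subset_span ⟨J, rfl⟩)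
  · intro h y hy
    obtain ⟨y, rfl⟩ := (mem_R_iff 𝕜).1 hy
    change ((W 𝕜 v j k)ᵀ *ᵥ y) ⬝ᵥ x = 0
    rw [mulVec_transpose, ← dotProduct_mulVec, h, dotProduct_zero]

theorem mem_perp_R_iff {v k j : ℕ} {x : KSubset v k → 𝕜} :
    x ∈ perp (R 𝕜 v k j) ↔ W 𝕜 v j k *ᵥ x = 0 := by
  rw [perp_R]
  rfl

theorem finrank_R_le (v k j : ℕ) : finrank 𝕜 (R 𝕜 v k j) ≤ v.choose j := by
  rw [← card_kSubset v j]
  exact finrank_range_le_card _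

theorem finrank_perp_R_add (v k j : ℕ) :
    finrank 𝕜 (perp (R 𝕜 v k j)) + finrank 𝕜 (R 𝕜 v k j) = v.choose k := by
  have h := (W 𝕜 v j k).mulVecLin.finrank_range_add_finrank_ker
  rw [← perp_R, finrank_fintype_fun_eq_card, card_kSubset] at h
  rw [← h, add_comm, R, ← rank_eq_finrank_span_row]
  rfl

/-! ### Harmonic vectors and the eigenvalue equation -/

/-- The vectors on `j`-subsets that are killed by `W_{lj}` for every `l < j`. -/
def harmonic (v j : ℕ) : Submodule 𝕜 (KSubset v j → 𝕜) where
  carrier := {h | ∀ l < j, W 𝕜 v l j *ᵥ h = 0}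
  zero_mem' := fun l _ => mulVec_zero _
  add_mem' := fun ha hb l hl => by rw [mulVec_add, ha l hl, hb l hl, add_zero]
  smul_mem' := fun c a ha l hl => by rw [mulVec_smul, ha l hl, smul_zero]

/-- The image of the harmonic vectors of degree `j` in the space of vectors on `k`-subsets. -/
def harmonicImage (v k j : ℕ) : Submodule 𝕜 (KSubset v k → 𝕜) :=
  (harmonic 𝕜 v j).map (W 𝕜 v j k)ᵀ.mulVecLin

variable {𝕜}

theorem W_mulVec_transpose_mulVec {v i j k : ℕ} (hik : i ≤ k) (hjk : j ≤ k) (hkv : 2 * k ≤ v)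
    {h : KSubset v j → 𝕜} (hh : h ∈ harmonic 𝕜 v j) :
    W 𝕜 v i k *ᵥ ((W 𝕜 v j k)ᵀ *ᵥ h) =
      ((v - j - i).choose (k - i) : 𝕜) • ((W 𝕜 v j i)ᵀ *ᵥ h) := by
  rw [mulVec_mulVec, W_mul_transpose 𝕜 (by omega) (by omega), sum_mulVec,
    -- The index `j` occurs because `j ≤ k ≤ v - k`.
    sum_eq_single_of_mem j (by rw [mem_range]; omega)]
  · rw [W_self, Matrix.mul_one, smul_mulVec, Nat.sub_right_comm,
      ← Nat.choose_symm (by omega : v - k - j ≤ v - j - i),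
      (by omega : v - j - i - (v - k - j) = k - i)]
  · intro l _ hlj
    rw [smul_mulVec, ← mulVec_mulVec]
    rcases lt_or_gt_of_ne hlj with hlt | hgt
    · rw [hh l hlt, mulVec_zero, smul_zero]
    · rw [W_eq_zero 𝕜 hgt, zero_mulVec, mulVec_zero, smul_zero]

theorem F_mulVec_of_mem {v k t j : ℕ} (htk : t ≤ k) (hkv : 2 * k ≤ v) (hjk : j ≤ k) (z : 𝕜)
    {h : KSubset v j → 𝕜} (hh : h ∈ harmonic 𝕜 v j) :
    F v k k t z *ᵥ ((W 𝕜 v j k)ᵀ *ᵥ h) = mu v k t j z • ((W 𝕜 v j k)ᵀ *ᵥ h) := by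
  have hterm : ∀ i ∈ range (t + 1), (z ^ i • A 𝕜 v k k i) *ᵥ ((W 𝕜 v j k)ᵀ *ᵥ h) =
      (((k - j).choose (k - i) : 𝕜) * ((v - j - i).choose (k - i) : 𝕜) * z ^ i) •
        ((W 𝕜 v j k)ᵀ *ᵥ h) := fun i hi => by
    have hik : i ≤ k := by rw [mem_range] at hi; omega
    rw [A_eq_transpose_mul, smul_mulVec, ← mulVec_mulVec, W_mulVec_transpose_mulVec hik hjk hkv hh,
      mulVec_smul, mulVec_mulVec, ← transpose_mul, W_mul_W 𝕜 hik, transpose_smul, smul_mulVec,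
      smul_smul, smul_smul]
    congr 1
    ring
  rw [F, sum_mulVec, sum_congr rfl hterm, ← sum_smul, mu]
  congr 1
  symm
  -- Terms with `i < j` vanish, as `k - i > k - j`.
  refine sum_subset_zero_on_sdiff (fun i hi => ?_) (fun i hi => ?_) (fun i hi => ?_)
  · rw [mem_Icc] at hi
    rw [mem_range]
    omega
  · rw [mem_sdiff, mem_range, mem_Icc] at hi
    rw [Nat.choose_eq_zero_of_lt (by omega : k - j < k - i)]
    simp
  · rw [mem_Icc] at hi
    rw [← Nat.choose_symm (by omega : i - j ≤ k - j)]
    congr 4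
    omega

theorem harmonicImage_le_R (v k j : ℕ) : harmonicImage 𝕜 v k j ≤ R 𝕜 v k j := by
  rintro _ ⟨h, -, rfl⟩
  exact (mem_R_iff 𝕜).2 ⟨h, rfl⟩

theorem harmonicImage_le_V {v j k : ℕ} (hjk : j ≤ k) (hkv : 2 * k ≤ v) :
    harmonicImage 𝕜 v k j ≤ V 𝕜 v k j := by
  cases j with
  | zero => exact harmonicImage_le_R v k 0
  | succ j =>
    refine le_inf (harmonicImage_le_R v k (j + 1)) ?_
    rintro _ ⟨h, hh, rfl⟩
    rw [mem_perp_R_iff, mulVecLin_apply, W_mulVec_transpose_mulVec (by omega) hjk hkv hh,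
      W_eq_zero 𝕜 j.lt_succ_self, transpose_zero, zero_mulVec, smul_zero]

theorem choose_pred_lt_choose {v j : ℕ} (h : 2 * (j + 1) ≤ v) : v.choose j < v.choose (j + 1) := by
  have h1 := Nat.choose_succ_right_eq v j
  have h2 : 0 < v.choose j := Nat.choose_pos (by omega)
  by_contra! hle
  have h3 : v.choose j * (v - j) ≤ v.choose j * (j + 1) := by
    rw [← h1]
    exact Nat.mul_le_mul_right _ hle
  have := Nat.le_of_mul_le_mul_left h3 h2
  omega

theorem mult_pos {v j : ℕ} (h : 2 * j ≤ v) : 0 < mult v j := by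
  cases j with
  | zero => simp [mult]
  | succ j => exact Nat.sub_pos_of_lt (choose_pred_lt_choose h)

theorem sum_mult {v t : ℕ} (h : 2 * t ≤ v) : ∑ j ∈ range (t + 1), mult v j = v.choose t := by
  induction t with
  | zero => simp [mult]
  | succ t ih =>
    rw [sum_range_succ, ih (by omega), mult]
    have := choose_pred_lt_choose h
    omega

/-- The candidate eigenvalues: `μ_0(z), …, μ_t(z)` and `0`. -/
def eigenvalue (v k t : ℕ) (z : 𝕜) : Option (Fin (t + 1)) → 𝕜
  | none => 0
  | some j => mu v k t j z

variable (𝕜) in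
/-- The candidate eigenspaces: the harmonic images of degree at most `t` and `R_t^⊥`. -/
def eigencomponent (v k t : ℕ) : Option (Fin (t + 1)) → Submodule 𝕜 (KSubset v k → 𝕜)
  | none => perp (R 𝕜 v k t)
  | some j => harmonicImage 𝕜 v k j

/-- The dimensions of the eigenspaces. -/
def eigendim (v k t : ℕ) : Option (Fin (t + 1)) → ℕ
  | none => v.choose k - v.choose t
  | some j => mult v j

theorem finrank_le_sum_eigendim {v k t : ℕ} (htk : t ≤ k) (hkv : 2 * k ≤ v) :
    finrank 𝕜 (KSubset v k → 𝕜) ≤ ∑ i, eigendim v k t i := by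
  rw [finrank_fintype_fun_eq_card, card_kSubset, Fintype.sum_option]
  simp only [eigendim]
  rw [Fin.sum_univ_eq_sum_range (mult v), sum_mult (by omega)]
  omega

/-! ### Dimensions in characteristic zero -/

variable [CharZero 𝕜]

theorem W_mulVec_eq_zero_of_le {v l j k : ℕ} (hlj : l ≤ j) (hjk : j ≤ k) {x : KSubset v k → 𝕜}
    (hx : W 𝕜 v j k *ᵥ x = 0) : W 𝕜 v l k *ᵥ x = 0 := by
  have h : (W 𝕜 v l j * W 𝕜 v j k) *ᵥ x = 0 := by rw [← mulVec_mulVec, hx, mulVec_zero]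
  rw [W_mul_W 𝕜 hjk, smul_mulVec] at h
  refine (smul_eq_zero.1 h).resolve_left (Nat.cast_ne_zero.2 (Nat.choose_pos ?_).ne')
  omega

theorem R_mono {v l j k : ℕ} (hlj : l ≤ j) (hjk : j ≤ k) : R 𝕜 v k l ≤ R 𝕜 v k j := by
  intro x hx
  obtain ⟨y, rfl⟩ := (mem_R_iff 𝕜).1 hx
  have hc : ((k - l).choose (k - j) : 𝕜) ≠ 0 := Nat.cast_ne_zero.2 (Nat.choose_pos (by omega)).ne'
  refine (mem_R_iff 𝕜).2 ⟨((k - l).choose (k - j) : 𝕜)⁻¹ • ((W 𝕜 v l j)ᵀ *ᵥ y), ?_⟩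
  rw [mulVec_smul, mulVec_mulVec, ← transpose_mul, W_mul_W 𝕜 hjk, transpose_smul, smul_mulVec,
    inv_smul_smul₀ hc]

/-- In degree `j + 1` the single condition `W_{j,j+1} h = 0` implies the lower ones, and it amounts
to at most `C(v,j)` independent equations. -/
theorem mult_le_finrank_harmonic (v j : ℕ) : mult v j ≤ finrank 𝕜 (harmonic 𝕜 v j) := by
  cases j with
  | zero =>
    have : harmonic 𝕜 v 0 = ⊤ := eq_top_iff.2 fun h _ l hl => absurd hl l.not_lt_zero
    rw [this, finrank_top, finrank_fintype_fun_eq_card, card_kSubset, mult]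
  | succ j =>
    have hle : perp (R 𝕜 v (j + 1) j) ≤ harmonic 𝕜 v (j + 1) := fun h hh l hl =>
      W_mulVec_eq_zero_of_le (Nat.le_of_lt_succ hl) j.le_succ ((mem_perp_R_iff 𝕜).1 hh)
    have h1 := Submodule.finrank_mono hle
    have h2 := finrank_perp_R_add 𝕜 v (j + 1) j
    have h3 := finrank_R_le 𝕜 v (j + 1) j
    rw [mult]
    omega

/-- On harmonic vectors `W_{jk} W_{jk}ᵀ` is a nonzero scalar, so `W_{jk}ᵀ` is injective there. -/
theorem finrank_harmonicImage {v j k : ℕ} (hjk : j ≤ k) (hkv : 2 * k ≤ v) :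
    finrank 𝕜 (harmonicImage 𝕜 v k j) = finrank 𝕜 (harmonic 𝕜 v j) := by
  rw [harmonicImage, ← LinearMap.range_domRestrict]
  refine LinearMap.finrank_range_of_inj ((injective_iff_map_eq_zero _).2 fun h hh => ?_)
  have hh' : (W 𝕜 v j k)ᵀ *ᵥ h.1 = 0 := hh
  have key := W_mulVec_transpose_mulVec hjk hjk hkv h.2
  rw [hh', mulVec_zero, W_self, transpose_one, one_mulVec] at key
  exact Subtype.ext ((smul_eq_zero.1 key.symm).resolve_left
    (Nat.cast_ne_zero.2 (Nat.choose_pos (by omega)).ne'))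

theorem perp_R_le_ker_F {v k t : ℕ} (htk : t ≤ k) (z : 𝕜) {x : KSubset v k → 𝕜}
    (hx : x ∈ perp (R 𝕜 v k t)) : F v k k t z *ᵥ x = 0 := by
  rw [F, sum_mulVec]
  refine sum_eq_zero fun i hi => ?_
  rw [A_eq_transpose_mul, smul_mulVec, ← mulVec_mulVec, W_mulVec_eq_zero_of_le
    (Nat.le_of_lt_succ (mem_range.1 hi)) htk ((mem_perp_R_iff 𝕜).1 hx), mulVec_zero, smul_zero]

theorem eigencomponent_le_eigenspace {v k t : ℕ} (htk : t ≤ k) (hkv : 2 * k ≤ v) (z : 𝕜)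
    (i : Option (Fin (t + 1))) :
    eigencomponent 𝕜 v k t i ≤
      End.eigenspace (Matrix.toLin' (F v k k t z)) (eigenvalue v k t z i) := by
  intro x hx
  rw [End.mem_eigenspace_iff, toLin'_apply]
  cases i with
  | none => rw [eigenvalue, zero_smul]; exact perp_R_le_ker_F htk z hx
  | some j =>
    obtain ⟨h, hh, rfl⟩ := hx
    exact F_mulVec_of_mem htk hkv (by omega) z hh

theorem eigendim_le_finrank {v k t : ℕ} (htk : t ≤ k) (hkv : 2 * k ≤ v)
    (i : Option (Fin (t + 1))) :
    eigendim v k t i ≤ finrank 𝕜 (eigencomponent 𝕜 v k t i) := by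
  cases i with
  | none =>
    have h1 := finrank_perp_R_add 𝕜 v k t
    have h2 := finrank_R_le 𝕜 v k t
    rw [eigendim, eigencomponent]
    omega
  | some j =>
    rw [eigendim, eigencomponent, finrank_harmonicImage (by omega) hkv]
    exact mult_le_finrank_harmonic v j

/-- No positivity of the form is used: the eigenspaces span, hence `R_t + R_t^⊥` is everything, and
the two dimensions are complementary. -/
theorem disjoint_R_perp {v k t : ℕ} (htk : t ≤ k) (hkv : 2 * k ≤ v) {z : 𝕜}
    (hz : Function.Injective (eigenvalue v k t z)) :
    Disjoint (R 𝕜 v k t) (perp (R 𝕜 v k t)) := by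
  have htop := (eigenspace_eq_of_finrank_le_sum _ _ hz _ _ (eigencomponent_le_eigenspace htk hkv z)
    (eigendim_le_finrank htk hkv) (finrank_le_sum_eigendim htk hkv)).2
  have hsup : R 𝕜 v k t ⊔ perp (R 𝕜 v k t) = ⊤ := by
    rw [eq_top_iff, ← htop, iSup_le_iff]
    rintro (_ | j)
    · exact le_sup_right
    · exact ((harmonicImage_le_R v k j).trans (R_mono (by omega) htk)).trans le_sup_left
  have h1 := Submodule.finrank_sup_add_finrank_inf_eq (R 𝕜 v k t) (perp (R 𝕜 v k t))
  have h2 := finrank_perp_R_add 𝕜 v k t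
  rw [hsup, finrank_top, finrank_fintype_fun_eq_card, card_kSubset] at h1
  rw [disjoint_iff, ← Submodule.finrank_eq_zero (R := 𝕜)]
  omega

theorem finrank_R {v k t : ℕ} (htk : t ≤ k) (hkv : 2 * k ≤ v) {z : 𝕜}
    (hz : Function.Injective (eigenvalue v k t z)) : finrank 𝕜 (R 𝕜 v k t) = v.choose t := by
  have h := ((eigenspace_eq_of_finrank_le_sum _ _ hz _ _ (eigencomponent_le_eigenspace htk hkv z)
    (eigendim_le_finrank htk hkv) (finrank_le_sum_eigendim htk hkv)).1 none).2
  have h1 := finrank_perp_R_add 𝕜 v k t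
  have h2 : v.choose t ≤ v.choose k := by
    rw [← sum_mult (by omega : 2 * t ≤ v), ← sum_mult hkv]
    exact sum_le_sum_of_subset (range_mono (by omega))
  rw [eigencomponent, eigendim] at h
  omega

/-- For `j + 1`, the space `V_{j+1}` meets `R_j` trivially inside `R_{j+1}`. This uses the results
with `t = j`, hence `hz` for all `t ≤ k`. -/
theorem finrank_V_le {v k j : ℕ} (hjk : j ≤ k) (hkv : 2 * k ≤ v) {z : 𝕜}
    (hz : ∀ t ≤ k, Function.Injective (eigenvalue v k t z)) :
    finrank 𝕜 (V 𝕜 v k j) ≤ mult v j := by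
  cases j with
  | zero => exact finrank_R_le 𝕜 v k 0
  | succ j =>
    have hj : j ≤ k := by omega
    have hdisj : Disjoint (R 𝕜 v k j) (V 𝕜 v k (j + 1)) :=
      (disjoint_R_perp hj hkv (hz j hj)).mono_right inf_le_right
    have hle : R 𝕜 v k j ⊔ V 𝕜 v k (j + 1) ≤ R 𝕜 v k (j + 1) :=
      sup_le (R_mono j.le_succ hjk) inf_le_left
    have h1 := Submodule.finrank_sup_add_finrank_inf_eq (R 𝕜 v k j) (V 𝕜 v k (j + 1))
    rw [hdisj.eq_bot, finrank_bot, finrank_R hj hkv (hz j hj)] at h1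
    have h2 := (Submodule.finrank_mono hle).trans (finrank_R_le 𝕜 v k (j + 1))
    rw [mult]
    omega

theorem V_eq_harmonicImage {v k j : ℕ} (hjk : j ≤ k) (hkv : 2 * k ≤ v) {z : 𝕜}
    (hz : ∀ t ≤ k, Function.Injective (eigenvalue v k t z)) :
    V 𝕜 v k j = harmonicImage 𝕜 v k j := by
  refine (Submodule.eq_of_le_of_finrank_le (harmonicImage_le_V hjk hkv) ?_).symm
  rw [finrank_harmonicImage hjk hkv]
  exact (finrank_V_le hjk hkv hz).trans (mult_le_finrank_harmonic v j)

end Inclusion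

/-! ### Distinctness of the eigenvalues over `ℝ(z)` -/

section RationalFunctions

open Polynomial

/-- The polynomial whose value at `z` is `μ_j(z)`. -/
noncomputable def muPoly (v k t j : ℕ) : ℝ[X] :=
  ∑ i ∈ Icc j t, C ((k - j).choose (i - j) * (v - j - i).choose (k - i) : ℝ) * X ^ i

theorem algebraMap_muPoly (v k t j : ℕ) :
    algebraMap ℝ[X] (RatFunc ℝ) (muPoly v k t j) = mu v k t j RatFunc.X := by
  simp [muPoly, mu]

theorem coeff_muPoly (v k t j n : ℕ) : (muPoly v k t j).coeff n =
    if n ∈ Icc j t then ((k - j).choose (n - j) * (v - j - n).choose (k - n) : ℝ) else 0 := by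
  simp only [muPoly, finsetSum_coeff, coeff_C_mul, coeff_X_pow, mul_ite, mul_one, mul_zero,
    Finset.sum_ite_eq]

theorem coeff_muPoly_self_ne_zero {v k t j : ℕ} (hjt : j ≤ t) (htk : t ≤ k) (hkv : 2 * k ≤ v) :
    (muPoly v k t j).coeff j ≠ 0 := by
  rw [coeff_muPoly, if_pos (by simpa using hjt), Nat.sub_self, Nat.choose_zero_right, Nat.cast_one,
    one_mul]
  exact Nat.cast_ne_zero.2 (Nat.choose_pos (by omega)).ne'

/-- The coefficient of `X ^ j` separates them. -/
theorem muPoly_ne_of_lt {v k t j l : ℕ} (hjl : j < l) (hlt : l ≤ t) (htk : t ≤ k)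
    (hkv : 2 * k ≤ v) : muPoly v k t j ≠ muPoly v k t l := by
  intro h
  refine coeff_muPoly_self_ne_zero (hjl.le.trans hlt) htk hkv ?_
  rw [h, coeff_muPoly, if_neg]
  rw [mem_Icc]
  omega

theorem mu_X_ne_zero {v k t j : ℕ} (hjt : j ≤ t) (htk : t ≤ k) (hkv : 2 * k ≤ v) :
    mu v k t j (RatFunc.X : RatFunc ℝ) ≠ 0 := by
  rw [← algebraMap_muPoly]
  refine RatFunc.algebraMap_ne_zero fun h => coeff_muPoly_self_ne_zero hjt htk hkv ?_
  rw [h, coeff_zero]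

theorem eigenvalue_X_injective {v k t : ℕ} (htk : t ≤ k) (hkv : 2 * k ≤ v) :
    Function.Injective (eigenvalue v k t (RatFunc.X : RatFunc ℝ)) := by
  rintro (_ | i) (_ | j) h
  · rfl
  · exact absurd h.symm (mu_X_ne_zero (by omega) htk hkv)
  · exact absurd h (mu_X_ne_zero (by omega) htk hkv)
  · simp only [eigenvalue, ← algebraMap_muPoly] at h
    have h' := RatFunc.algebraMap_injective ℝ h
    rcases lt_trichotomy (i : ℕ) j with hij | hij | hij
    · exact absurd h' (muPoly_ne_of_lt hij (by omega) htk hkv)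
    · rw [Fin.ext hij]
    · exact absurd h'.symm (muPoly_ne_of_lt hij (by omega) htk hkv)

end RationalFunctions

end IntersectionMatrix

theorem mainTheorem1 (v k t : ℕ) (htk : t ≤ k) (hkv : 2 * k ≤ v) :
    (IntersectionMatrix.F v k k t (RatFunc.X : RatFunc ℝ)).charpoly =
        (∏ j ∈ Finset.range (t + 1),
          (Polynomial.X - Polynomial.C (IntersectionMatrix.mu v k t j (RatFunc.X : RatFunc ℝ))) ^
            IntersectionMatrix.mult v j) *
          Polynomial.X ^ (v.choose k - v.choose t) ∧
    (∀ j ≤ t,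
      Module.End.HasEigenvalue
          (Matrix.toLin' (IntersectionMatrix.F v k k t (RatFunc.X : RatFunc ℝ)))
          (IntersectionMatrix.mu v k t j RatFunc.X) ∧
        Module.End.eigenspace
          (Matrix.toLin' (IntersectionMatrix.F v k k t (RatFunc.X : RatFunc ℝ)))
          (IntersectionMatrix.mu v k t j RatFunc.X) = IntersectionMatrix.V (RatFunc ℝ) v k j ∧
        Module.finrank (RatFunc ℝ) (IntersectionMatrix.V (RatFunc ℝ) v k j) =
          IntersectionMatrix.mult v j) ∧
    Module.End.eigenspace
        (Matrix.toLin' (IntersectionMatrix.F v k k t (RatFunc.X : RatFunc ℝ))) 0 =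
      IntersectionMatrix.perp (IntersectionMatrix.R (RatFunc ℝ) v k t) ∧
    Module.finrank (RatFunc ℝ) (IntersectionMatrix.perp (IntersectionMatrix.R (RatFunc ℝ) v k t)) =
      v.choose k - v.choose t := by 
  have hz : ∀ t ≤ k, Function.Injective
      (IntersectionMatrix.eigenvalue v k t (RatFunc.X : RatFunc ℝ)) :=
    fun t ht => IntersectionMatrix.eigenvalue_X_injective ht hkv
  have hE := IntersectionMatrix.eigencomponent_le_eigenspace htk hkv (RatFunc.X : RatFunc ℝ)
  have hd := IntersectionMatrix.eigendim_le_finrank (𝕜 := RatFunc ℝ) htk hkv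
  have hs := IntersectionMatrix.finrank_le_sum_eigendim (𝕜 := RatFunc ℝ) htk hkv
  have main := (IntersectionMatrix.eigenspace_eq_of_finrank_le_sum _ _ (hz t htk) _ _ hE hd hs).1
  refine ⟨?_, fun j hj => ?_, (main none).1, (main none).2⟩
  · rw [← Matrix.charpoly_toLin', IntersectionMatrix.charpoly_eq_prod_of_finrank_le_sum _ _
      (hz t htk) _ (fun i => (hd i).trans (Submodule.finrank_mono (hE i))) hs, Fintype.prod_option,
      mul_comm, ← Fin.prod_univ_eq_prod_range (fun j => (Polynomial.X - Polynomial.C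
        (IntersectionMatrix.mu v k t j (RatFunc.X : RatFunc ℝ))) ^ IntersectionMatrix.mult v j)]
    simp only [IntersectionMatrix.eigenvalue, IntersectionMatrix.eigendim, map_zero, sub_zero]
  · obtain ⟨h1, h2⟩ := main (some ⟨j, Nat.lt_succ_of_le hj⟩)
    change _ = IntersectionMatrix.harmonicImage (RatFunc ℝ) v k j at h1
    change Module.finrank (RatFunc ℝ) (IntersectionMatrix.harmonicImage (RatFunc ℝ) v k j) =
      IntersectionMatrix.mult v j at h2
    rw [IntersectionMatrix.V_eq_harmonicImage (hj.trans htk) hkv hz]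
    refine ⟨?_, h1, h2⟩
    refine Module.End.hasEigenvalue_iff.2 fun hbot => ?_
    have hbot := h1.symm.trans hbot
    rw [hbot, finrank_bot] at h2
    exact (IntersectionMatrix.mult_pos (by omega : 2 * j ≤ v)).ne h2
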